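/- Let $k\ge 1$, $0\le t\le k$ and $n\ge 1$ be integers. A $k_t$-Dyck path is a lattice path consisting of up-steps $(1,k)$ and down-steps $(1,-1)$ that starts at $(0,0)$, stays weakly above the line $y=-t$, and ends on the line $y=0$; if it has length $(k+1)m$, it has exactly $m$ up-steps. For integers $m\ge1$, $0\le u\le k$ and $0\le r\le m$, let $s_{m,u,r}$ be the total number of down-steps between the $r$-th and the $(r+1)$-th up-steps in all $k_u$-Dyck paths of length $(k+1)m$, where for $r=0$ all down-steps before the first up-step are counted, and for $r=m$ all down-steps after the last up-step. For integers $m,u\ge0$ let $$C_{m,u}=\frac{u+1}{(k+1)m+u+1}\binom{(k+1)m+u+1}{m}.$$ Then the following statements hold. (1) $\displaystyle s_{n,t,0}=\sum_{j=0}^{t-1}C_{n,j}$. (2) $\displaystyle s_{n,0,1}=\sum_{j=0}^{k-1}C_{n-1,j}=\frac{k}{n}\binom{(k+1)(n-1)}{n-1}$. (3) For every integer $r$ with $1\le r\le n$, $$s_{n,t,r}=s_{n,t,r-1}+C_{r,t}\bigl(s_{n-r+1,0,1}-t\,[r=n]\bigr),$$ where $[r=n]$ is $1$ if $r=n$ and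 $0$ otherwise. -/

import Mathlib

namespace KtDyck

/-- The final height of the lattice path with up-steps `(1, k)` and down-steps `(1, -1)` that starts
at `(0, 0)` and is encoded by the word `w`, with `true` for an up-step and `false` for a
down-step. -/
def height (k : ℕ) (w : List Bool) : ℤ :=
  (w.map fun b => if b then (k : ℤ) else -1).sum

/-- A `k_t`-Dyck path: every point of the path, that is, the endpoint of the path after its first
`i` steps, lies weakly above the line `y = -t`, and the path ends on the line `y = 0`. -/
def IsPath (k t : ℕ) (w : List Bool) : Prop :=
  (∀ i ≤ w.length, -(t : ℤ) ≤ height k (w.take i)) ∧ height k w = 0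

instance (k t : ℕ) : DecidablePred (IsPath k t) := fun w => by
  unfold IsPath; infer_instance

/-- All words of length `m` in the two kinds of steps. -/
def words (m : ℕ) : Finset (List Bool) :=
  (Finset.univ : Finset (List.Vector Bool m)).map ⟨Subtype.val, Subtype.val_injective⟩

theorem mem_words {m : ℕ} {w : List Bool} : w ∈ words m ↔ w.length = m := by
  constructor
  · intro h
    obtain ⟨v, -, rfl⟩ := Finset.mem_map.1 h
    exact v.2
  · intro h
    exact Finset.mem_map.2 ⟨⟨w, h⟩, @Finset.mem_univ (List.Vector Bool m) _ _, rfl⟩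

/-- The `k_t`-Dyck paths of length `(k + 1) n`, which are those with `n` up-steps. -/
def paths (k t n : ℕ) : Finset (List Bool) :=
  (words ((k + 1) * n)).filter (IsPath k t)

theorem mem_paths {k t n : ℕ} {w : List Bool} :
    w ∈ paths k t n ↔ w.length = (k + 1) * n ∧ IsPath k t w := by
  rw [paths, Finset.mem_filter, mem_words]

/-- The number of down-steps of `w` that come after the `r`-th up-step (if `r > 0`) and before the
`(r + 1)`-th up-step (if there is one): the down-steps with exactly `r` up-steps to their left. -/
def downSteps (r : ℕ) (w : List Bool) : ℕ :=
  ((Finset.range w.length).filter fun i => w[i]? = some false ∧ (w.take i).count true = r).card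

/-- `s k n t r` is the total number of down-steps between the `r`-th and the `(r + 1)`-th up-steps
in all `k_t`-Dyck paths of length `(k + 1) n`. -/
def s (k n t r : ℕ) : ℕ :=
  ∑ w ∈ paths k t n, downSteps r w

/-- The generalized Fuss-Catalan number `C_{n,t}^{(k)}`. -/
def C (k n t : ℕ) : ℚ :=
  ((t : ℚ) + 1) / (((k : ℚ) + 1) * n + t + 1) * (((k + 1) * n + t + 1).choose n : ℚ)

end KtDyck

namespace KtDyck

/-! Raise paths by `t` and let the starting height `h` vary, so that removing the first step gives
recursions. With `m` up-steps there are `C k m h` paths (`pathSum_one`). Splitting at the height `x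
≤ h` from which the first up-step leaves gives both `C k (m + 1) h` and the down-step totals
`downTotal` as sums over `x` of their values at `(m, x + k)`.

Hence `downTotal (r + 1) - downTotal r` and `C k (r + 1) h` obey the same recursion in `r`, and only
the base case needs work: there the difference is `h + 1 = C k 1 h` times the constant `downTotal k
t 0 n k` (`downTotal_succ_sub`). That constant is `s k (n + 1) 0 1`, lowered by `t` when `n = 0`. -/

/-- A path that starts at height `h`, stays weakly above height `0` and ends at height `t`. -/
def IsShifted (k t : ℕ) (h : ℤ) (w : List Bool) : Prop :=
  (∀ i ≤ w.length, 0 ≤ h + height k (w.take i)) ∧ h + height k w = t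

instance (k t : ℕ) (h : ℤ) : DecidablePred (IsShifted k t h) := fun w => by
  unfold IsShifted; infer_instance

theorem height_nil (k : ℕ) : height k [] = 0 := rfl

theorem height_cons (k : ℕ) (b : Bool) (w : List Bool) :
    height k (b :: w) = (if b then (k : ℤ) else -1) + height k w := by
  simp [height]

theorem isPath_iff_isShifted (k t : ℕ) (w : List Bool) : IsPath k t w ↔ IsShifted k t t w := by
  unfold IsPath IsShifted
  refine and_congr (forall₂_congr fun i _ => ?_) ?_ <;> constructor <;> intro h <;> linarith

theorem isShifted_nil (k t : ℕ) (h : ℤ) : IsShifted k t h [] ↔ h = t := by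
  constructor
  · intro H
    simpa [height_nil] using H.2
  · rintro rfl
    simp [IsShifted, height_nil]

theorem isShifted_cons (k t : ℕ) (h : ℤ) (b : Bool) (w : List Bool) :
    IsShifted k t h (b :: w) ↔
      0 ≤ h ∧ IsShifted k t (h + (if b then (k : ℤ) else -1)) w := by
  unfold IsShifted
  rw [height_cons, ← add_assoc, ← and_assoc]
  refine and_congr_left fun _ => ⟨fun H => ⟨?_, fun i hi => ?_⟩, fun H i hi => ?_⟩
  · simpa [height_nil] using H 0 (by simp)
  · simpa [height_cons, add_assoc] using H (i + 1) (by simpa using hi)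
  · cases i with
    | zero => simpa [height_nil] using H.1
    | succ i => simpa [height_cons, add_assoc] using H.2 i (by simpa using hi)

theorem not_isShifted_of_neg {k t : ℕ} {h : ℤ} (hh : h < 0) (w : List Bool) :
    ¬ IsShifted k t h w := by
  intro H
  have := H.1 0 (Nat.zero_le _)
  simp [height_nil] at this
  omega

theorem downSteps_nil (r : ℕ) : downSteps r [] = 0 := rfl

theorem downSteps_cons (r : ℕ) (b : Bool) (w : List Bool) :
    downSteps r (b :: w) = (if b = false ∧ r = 0 then 1 else 0) +
      ((Finset.range w.length).filter fun i =>
        w[i]? = some false ∧ (w.take i).count true + (if b then 1 else 0) = r).card := by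
  unfold downSteps
  rw [Finset.card_filter, List.length_cons, Finset.sum_range_succ', Finset.card_filter, add_comm]
  congr 1
  · simp [eq_comm]
  · refine Finset.sum_congr rfl fun i _ => ?_
    cases b <;> simp

theorem downSteps_zero_true_cons (w : List Bool) : downSteps 0 (true :: w) = 0 := by
  simp [downSteps_cons]

theorem downSteps_succ_true_cons (r : ℕ) (w : List Bool) :
    downSteps (r + 1) (true :: w) = downSteps r w := by
  rw [downSteps_cons]
  simp [downSteps]

theorem downSteps_zero_false_cons (w : List Bool) :
    downSteps 0 (false :: w) = 1 + downSteps 0 w := by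
  rw [downSteps_cons]
  simp [downSteps]

theorem downSteps_succ_false_cons (r : ℕ) (w : List Bool) :
    downSteps (r + 1) (false :: w) = downSteps (r + 1) w := by
  rw [downSteps_cons]
  simp [downSteps]

/-! ### First-step recursion for sums over paths. -/

theorem words_zero : words 0 = {[]} := by
  ext w
  simp [mem_words]

theorem sum_words_succ (L : ℕ) (f : List Bool → ℚ) :
    ∑ w ∈ words (L + 1), f w = ∑ w ∈ words L, f (true :: w) + ∑ w ∈ words L, f (false :: w) := by
  have hsplit : words (L + 1) =
      (words L).image (List.cons true) ∪ (words L).image (List.cons false) := by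
    ext w
    cases w with
    | nil => simp [mem_words]
    | cons b w => cases b <;> simp [mem_words]
  rw [hsplit, Finset.sum_union, Finset.sum_image (by simp), Finset.sum_image (by simp)]
  rw [Finset.disjoint_left]
  simp only [Finset.mem_image]
  rintro _ ⟨w, -, rfl⟩ ⟨v, -, hv⟩
  simp at hv

/-- The sum of `f` over all paths of length `L` from height `h` to height `t` that stay weakly
above height `0`. -/
def pathSum (k t : ℕ) (f : List Bool → ℚ) (L : ℕ) (h : ℤ) : ℚ :=
  ∑ w ∈ words L, if IsShifted k t h w then f w else 0

theorem pathSum_zero (k t : ℕ) (f : List Bool → ℚ) (h : ℤ) :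
    pathSum k t f 0 h = if h = t then f [] else 0 := by
  simp [pathSum, words_zero, isShifted_nil]

theorem pathSum_of_neg {k t : ℕ} (f : List Bool → ℚ) (L : ℕ) {h : ℤ} (hh : h < 0) :
    pathSum k t f L h = 0 := by
  simp [pathSum, not_isShifted_of_neg hh]

theorem pathSum_succ (k t : ℕ) (f : List Bool → ℚ) (L h : ℕ) :
    pathSum k t f (L + 1) h =
      pathSum k t (fun w => f (true :: w)) L ((h + k : ℕ) : ℤ) +
        pathSum k t (fun w => f (false :: w)) L ((h : ℤ) - 1) := by
  rw [pathSum, sum_words_succ]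
  congr 1 <;> refine Finset.sum_congr rfl fun w _ => if_congr ?_ rfl rfl <;>
    simp [isShifted_cons, sub_eq_add_neg]

theorem pathSum_zero_fun (k t L : ℕ) (h : ℤ) : pathSum k t (fun _ => 0) L h = 0 := by
  simp [pathSum]

theorem pathSum_add (k t : ℕ) (f g : List Bool → ℚ) (L : ℕ) (h : ℤ) :
    pathSum k t (fun w => f w + g w) L h = pathSum k t f L h + pathSum k t g L h := by
  rw [pathSum, pathSum, pathSum, ← Finset.sum_add_distrib]
  refine Finset.sum_congr rfl fun w _ => ?_
  split_ifs <;> simp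

/-- A path descends by at most one unit per step. -/
theorem pathSum_of_lt {k t : ℕ} (f : List Bool → ℚ) {L h : ℕ} (hh : L + t < h) :
    pathSum k t f L h = 0 := by
  induction L generalizing f h with
  | zero =>
    rw [pathSum_zero, if_neg]
    omega
  | succ L ih =>
    obtain ⟨h, rfl⟩ : ∃ g, h = g + 1 := ⟨h - 1, by omega⟩
    rw [pathSum_succ, ih _ (by omega)]
    simpa using ih (fun w => f (false :: w)) (h := h) (by omega)

/-! ### Recurrences and partial sums of the Fuss-Catalan numbers. -/

theorem C_zero (k u : ℕ) : C k 0 u = 1 := by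
  have : (u : ℚ) + 1 ≠ 0 := by positivity
  simp [C, this]

theorem C_succ_zero (k m : ℕ) : C k (m + 1) 0 = C k m k := by
  have h := Nat.add_one_mul_choose_eq ((k + 1) * m + k + 1) m
  have h' : (((k + 1) * m + k + 1 + 1 : ℕ) : ℚ) * (((k + 1) * m + k + 1).choose m : ℚ) =
      (((k + 1) * m + k + 1 + 1).choose (m + 1) : ℚ) * ((m + 1 : ℕ) : ℚ) := by exact_mod_cast h
  have e : (k + 1) * (m + 1) + 0 + 1 = (k + 1) * m + k + 1 + 1 := by ring
  unfold C
  rw [e]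
  push_cast at h' ⊢
  have h1 : ((k : ℚ) + 1) * m + k + 1 ≠ 0 := by positivity
  have h2 : ((k : ℚ) + 1) * (m + 1) + 0 + 1 ≠ 0 := by positivity
  have h3 : (m : ℚ) + 1 ≠ 0 := by positivity
  rw [div_mul_eq_mul_div, div_mul_eq_mul_div, div_eq_div_iff h2 h1]
  linear_combination (-(k : ℚ) - 1) * h'

theorem C_succ_succ (k m u : ℕ) : C k (m + 1) (u + 1) = C k m (u + 1 + k) + C k (m + 1) u := by
  obtain ⟨A, hA⟩ : ∃ A, A = (k + 1) * m + u + 1 + k + 1 := ⟨_, rfl⟩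
  have e1 : (k + 1) * (m + 1) + (u + 1) + 1 = A + 1 := by rw [hA]; ring
  have e2 : (k + 1) * m + (u + 1 + k) + 1 = A := by rw [hA]; ring
  have e3 : (k + 1) * (m + 1) + u + 1 = A := by rw [hA]; ring
  have hAq : (A : ℚ) = (k + 1) * m + u + 1 + k + 1 := by rw [hA]; push_cast; ring
  have hmA : m ≤ A := by nlinarith [Nat.zero_le (k * m)]
  have h1 : ((A.choose (m + 1) : ℕ) : ℚ) * (m + 1) = A.choose m * (A - m) := by
    have := Nat.choose_succ_right_eq A m
    rw [← Nat.cast_sub hmA]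
    exact_mod_cast this
  have h2 : (((A + 1).choose (m + 1) : ℕ) : ℚ) = A.choose m + A.choose (m + 1) := by
    exact_mod_cast Nat.choose_succ_succ A m
  have hm : (m : ℚ) + 1 ≠ 0 := by positivity
  have hA0 : (A : ℚ) ≠ 0 := by rw [hAq]; positivity
  have hA1 : (A : ℚ) + 1 ≠ 0 := by positivity
  have h3 : ((A.choose (m + 1) : ℕ) : ℚ) = A.choose m * (A - m) / (m + 1) := by
    rw [eq_div_iff hm, h1]
  unfold C
  rw [e1, e2, e3, h2, h3]
  have d1 : ((k : ℚ) + 1) * ((m + 1 : ℕ) : ℚ) + ((u + 1 : ℕ) : ℚ) + 1 = A + 1 := by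
    rw [hAq]; push_cast; ring
  have d2 : ((k : ℚ) + 1) * m + ((u + 1 + k : ℕ) : ℚ) + 1 = A := by
    rw [hAq]; push_cast; ring
  have d3 : ((k : ℚ) + 1) * ((m + 1 : ℕ) : ℚ) + u + 1 = A := by
    rw [hAq]; push_cast; ring
  rw [d1, d2, d3]
  have hu : (u : ℚ) = A - (k + 1) * m - k - 2 := by rw [hAq]; ring
  push_cast
  rw [hu]
  field_simp
  ring

theorem C_succ_eq_sum (k m u : ℕ) :
    C k (m + 1) u = ∑ x ∈ Finset.range (u + 1), C k m (x + k) := by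
  induction u with
  | zero => simp [C_succ_zero]
  | succ u ih => rw [Finset.sum_range_succ, ← ih, C_succ_succ, add_comm]

/-- The sum telescopes. At `K = k` the second term vanishes, leaving the closed form in (2). -/
theorem sum_C (k m K : ℕ) :
    ∑ j ∈ Finset.range K, C k m j =
      k / (m + 1) * (((k + 1) * m).choose m : ℚ) -
        (k - K) / (m + 1) * (((k + 1) * m + K).choose m : ℚ) := by
  induction K with
  | zero => simp
  | succ K ih =>
    rw [Finset.sum_range_succ, ih]
    obtain ⟨A, hA⟩ : ∃ A, A = (k + 1) * m + K := ⟨_, rfl⟩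
    have hAq : (A : ℚ) = (k + 1) * m + K := by rw [hA]; push_cast; ring
    have hmA : m ≤ A + 1 := by nlinarith [Nat.zero_le (k * m)]
    have h1 : ((A.choose m : ℕ) : ℚ) * (A + 1) = (A + 1).choose m * (A + 1 - m) := by
      have := Nat.choose_mul_succ_eq A m
      rw [← Nat.cast_add_one, ← Nat.cast_sub hmA]
      exact_mod_cast this
    have hA1 : (A : ℚ) + 1 ≠ 0 := by positivity
    have hm : (m : ℚ) + 1 ≠ 0 := by positivity
    have h2 : ((A.choose m : ℕ) : ℚ) = (A + 1).choose m * (A + 1 - m) / (A + 1) := by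
      rw [eq_div_iff hA1, h1]
    unfold C
    rw [← add_assoc, ← hA, ← hAq, h2]
    have hK : (K : ℚ) = A - (k + 1) * m := by rw [hAq]; ring
    push_cast
    rw [hK]
    field_simp
    ring

/-- `hL` says that the path has `m` up-steps. The count is independent of `t`: as `t ≤ k`, the last
up-step ends at height at least `t`, and the remaining descent is forced. -/
theorem pathSum_one {k t : ℕ} (ht : t ≤ k) {L m h : ℕ} (hL : L + t = (k + 1) * m + h) :
    pathSum k t (fun _ => 1) L h = C k m h := by
  induction L generalizing m h with
  | zero =>
    obtain rfl : m = 0 := by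
      by_contra hm
      have := Nat.le_mul_of_pos_right (k + 1) (Nat.pos_of_ne_zero hm)
      omega
    rw [pathSum_zero, if_pos (by omega), C_zero]
  | succ L ih =>
    rw [pathSum_succ]
    cases m with
    | zero =>
      obtain ⟨h, rfl⟩ : ∃ g, h = g + 1 := ⟨h - 1, by omega⟩
      -- With no up-steps to spare, going up leaves too few steps to come back down to `t`.
      rw [pathSum_of_lt _ (by omega), C_zero, zero_add]
      simpa [C_zero] using ih (m := 0) (h := h) (by omega)
    | succ m =>
      rw [mul_add] at hL
      rw [ih (m := m) (by omega)]
      cases h with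
      | zero => simp [pathSum_of_neg, C_succ_zero]
      | succ h =>
        rw [C_succ_succ]
        simpa using ih (m := m + 1) (h := h) (by rw [mul_add]; omega)

/-! ### Down-step totals. -/

/-- The total number of down-steps with exactly `r` up-steps to their left in all paths with `m`
up-steps from height `h` to height `t` that stay weakly above height `0`. -/
def downTotal (k t : ℕ) : ℕ → ℕ → ℕ → ℚ
  -- An initial down-step from `x + 1` to `x` is counted once for each continuation from `x`; there
  -- is none if `m = 0` and `x < t`.
  | 0, m, h => ∑ x ∈ Finset.range h, if m = 0 ∧ x < t then 0 else C k m x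
  | _ + 1, 0, _ => 0
  | r + 1, m + 1, h => ∑ x ∈ Finset.range (h + 1), downTotal k t r m (x + k)

theorem pathSum_downSteps {k t : ℕ} (ht : t ≤ k) (r : ℕ) {L m h : ℕ}
    (hL : L + t = (k + 1) * m + h) :
    pathSum k t (fun w => (downSteps r w : ℚ)) L h = downTotal k t r m h := by
  induction L generalizing r m h with
  | zero =>
    obtain rfl : m = 0 := by
      by_contra hm
      have := Nat.le_mul_of_pos_right (k + 1) (Nat.pos_of_ne_zero hm)
      omega
    obtain rfl : t = h := by omega
    rw [pathSum_zero, downSteps_nil]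
    cases r with
    | zero =>
      rw [downTotal, Finset.sum_eq_zero]
      · simp
      · intro x hx
        simp [Finset.mem_range.1 hx]
    | succ r => simp [downTotal]
  | succ L ih =>
    rw [pathSum_succ]
    cases r with
    | zero =>
      simp only [downSteps_zero_true_cons, downSteps_zero_false_cons, Nat.cast_zero,
        Nat.cast_add, Nat.cast_one, pathSum_zero_fun, pathSum_add, zero_add]
      cases h with
      | zero => simp [pathSum_of_neg, downTotal]
      | succ h =>
        have e : ((h + 1 : ℕ) : ℤ) - 1 = (h : ℕ) := by simp
        rw [e, ih 0 (m := m) (by omega), pathSum_one ht (m := m) (by omega), downTotal, downTotal,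
          Finset.sum_range_succ, add_comm, if_neg]
        rintro ⟨rfl, h1⟩
        omega
    | succ r =>
      simp only [downSteps_succ_true_cons, downSteps_succ_false_cons]
      cases m with
      | zero =>
        obtain ⟨h, rfl⟩ : ∃ g, h = g + 1 := ⟨h - 1, by omega⟩
        have e : ((h + 1 : ℕ) : ℤ) - 1 = (h : ℕ) := by simp
        rw [pathSum_of_lt _ (by omega), e, ih (r + 1) (m := 0) (by omega)]
        simp [downTotal]
      | succ m =>
        have hL' := hL
        rw [mul_add] at hL'
        rw [ih r (m := m) (by omega)]
        cases h with
        | zero => simp [pathSum_of_neg, downTotal]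
        | succ h =>
          have e : ((h + 1 : ℕ) : ℤ) - 1 = (h : ℕ) := by simp
          rw [e, ih (r + 1) (m := m + 1) (by omega), downTotal, downTotal,
            Finset.sum_range_succ _ (h + 1), add_comm]

theorem s_eq_downTotal {k t : ℕ} (ht : t ≤ k) (n r : ℕ) :
    (s k n t r : ℚ) = downTotal k t r n t := by
  rw [← pathSum_downSteps ht r (L := (k + 1) * n) rfl, s, pathSum, paths, Finset.sum_filter]
  push_cast
  refine Finset.sum_congr rfl fun w _ => ?_
  exact if_congr (isPath_iff_isShifted k t w) rfl rfl

/-- Raising `h` by one adds `downTotal k t 0 n (h + 1 + k)` to the first total and `C k (n + 1) h`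
to the second. By `C_succ_eq_sum` these differ by `downTotal k t 0 n k`, whatever `h` is. -/
theorem downTotal_one_sub_zero {k t : ℕ} (ht : t ≤ k) (n h : ℕ) :
    downTotal k t 1 (n + 1) h - downTotal k t 0 (n + 1) h =
      (h + 1) * downTotal k t 0 n k := by
  induction h with
  | zero => simp [downTotal]
  | succ h ih =>
    have h1 : downTotal k t 1 (n + 1) (h + 1) =
        downTotal k t 1 (n + 1) h + downTotal k t 0 n (h + 1 + k) := by
      rw [downTotal.eq_3, downTotal.eq_3, Finset.sum_range_succ _ (h + 1)]
    have h2 : downTotal k t 0 (n + 1) (h + 1) = downTotal k t 0 (n + 1) h + C k (n + 1) h := by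
      simp [downTotal, Finset.sum_range_succ]
    have h3 : downTotal k t 0 n (h + 1 + k) = downTotal k t 0 n k + C k (n + 1) h := by
      rw [downTotal, downTotal, add_comm (h + 1) k, Finset.sum_range_add, C_succ_eq_sum]
      congr 1
      refine Finset.sum_congr rfl fun x _ => ?_
      rw [if_neg (by omega), add_comm]
    push_cast
    linear_combination ih + h1 - h2 + h3

theorem downTotal_succ_sub {k t : ℕ} (ht : t ≤ k) (r n h : ℕ) :
    downTotal k t (r + 1) (n + r + 1) h - downTotal k t r (n + r + 1) h =
      C k (r + 1) h * downTotal k t 0 n k := by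
  induction r generalizing h with
  | zero =>
    rw [C_succ_eq_sum, add_zero, downTotal_one_sub_zero ht]
    simp [C_zero]
  | succ r ih =>
    rw [← add_assoc n r 1, downTotal.eq_3, downTotal.eq_3, ← Finset.sum_sub_distrib,
      Finset.sum_congr rfl fun x _ => ih (x + k), ← Finset.sum_mul, ← C_succ_eq_sum]

theorem downTotal_zero_of_ne_zero (k t : ℕ) {m : ℕ} (hm : m ≠ 0) (h : ℕ) :
    downTotal k t 0 m h = ∑ j ∈ Finset.range h, C k m j := by
  simp [downTotal, hm]

theorem downTotal_zero_zero {k t h : ℕ} (ht : t ≤ h) : downTotal k t 0 0 h = h - t := by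
  obtain ⟨d, rfl⟩ := Nat.exists_eq_add_of_le ht
  rw [downTotal, Finset.sum_range_add, Finset.sum_eq_zero]
  · simp [C_zero]
  · intro x hx
    simp [Finset.mem_range.1 hx]

theorem s_zero_one (k m : ℕ) : (s k (m + 1) 0 1 : ℚ) = ∑ j ∈ Finset.range k, C k m j := by
  rw [s_eq_downTotal (Nat.zero_le k)]
  simp [downTotal]

end KtDyck

theorem theorem3p1 (k t n : ℕ) (hk : 1 ≤ k) (ht : t ≤ k) (hn : 1 ≤ n) :
    ((KtDyck.s k n t 0 : ℚ) = ∑ j ∈ Finset.range t, KtDyck.C k n j) ∧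
    ((KtDyck.s k n 0 1 : ℚ) = ∑ j ∈ Finset.range k, KtDyck.C k (n - 1) j ∧
      (KtDyck.s k n 0 1 : ℚ) =
        (k : ℚ) / (n : ℚ) * (((k + 1) * (n - 1)).choose (n - 1) : ℚ)) ∧
    (∀ r : ℕ, 1 ≤ r → r ≤ n →
      (KtDyck.s k n t r : ℚ) = (KtDyck.s k n t (r - 1) : ℚ) +
        KtDyck.C k r t * ((KtDyck.s k (n - r + 1) 0 1 : ℚ) - (t : ℚ) * (if r = n then 1 else 0))) := by
  refine ⟨?_, ?_, fun r hr hrn => ?_⟩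
  · rw [KtDyck.s_eq_downTotal ht, KtDyck.downTotal_zero_of_ne_zero k t (by omega)]
  · obtain ⟨m, rfl⟩ : ∃ m, n = m + 1 := ⟨n - 1, by omega⟩
    refine ⟨KtDyck.s_zero_one k m, ?_⟩
    rw [KtDyck.s_zero_one, KtDyck.sum_C]
    simp
  · obtain ⟨r, rfl⟩ : ∃ q, r = q + 1 := ⟨r - 1, by omega⟩
    obtain ⟨m, rfl⟩ : ∃ m, n = m + r + 1 := ⟨n - (r + 1), by omega⟩
    have key := KtDyck.downTotal_succ_sub ht r m t
    have e : m + r + 1 - (r + 1) = m := by omega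
    have hfactor : KtDyck.downTotal k t 0 m k =
        (KtDyck.s k (m + 1) 0 1 : ℚ) - t * (if r + 1 = m + r + 1 then 1 else 0) := by
      rw [KtDyck.s_zero_one]
      rcases eq_or_ne m 0 with rfl | hm
      -- For `r = n` both sides are `k - t`: the final descent from `k` stops at `t` instead of `0`,
      -- whence the correction term.
      · simp [KtDyck.downTotal_zero_zero ht, KtDyck.C_zero]
      · rw [KtDyck.downTotal_zero_of_ne_zero k t hm, if_neg (by omega)]
        simp
    rw [e, KtDyck.s_eq_downTotal ht, KtDyck.s_eq_downTotal ht, ← hfactor, ← key]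
    simp
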